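/- Let $0<\kappa\le 1$ and let $\mathcal{E}_\kappa(z)=\sum_{m=0}^{\infty}\frac{z^m}{\Gamma(\kappa m+1)}$, $z\in\mathbb{R}$, be the Mittag-Leffler function. For $0<\kappa<1$ let $ML(\kappa)$ be the (type 2) Mittag-Leffler distribution, i.e. the distribution on $(0,\infty)$ with density $$f_\kappa(u)=\frac{1}{\pi\kappa}\sum_{j=1}^{\infty}\frac{(-1)^{j-1}}{j!}\sin(\pi\kappa j)\,\Gamma(\kappa j+1)\,u^{j-1},\quad u>0,$$ and let $ML(1)$ be the point mass at $1$. Say that a real random variable $Y$ has the standard Normal-Mittag-Leffler distribution, $Y\sim NML(\kappa)$, if $Y$ has the same distribution as $\sqrt{U}\,Z$, where $U\sim ML(\kappa)$ and $Z\sim N(0,1)$ are independent. If $Y\sim NML(\kappa)$, then the characteristic function of $Y$ is $\varphi_Y(t)=\mathcal{E}_\kappa(-t^2/2)$, $t\in\mathbb{R}$; it is integrable over $\mathbb{R}$; and $Y$ has the (nonnegative) probability density function $$f_Y(y)=\frac{1}{\pi}\int_0^\infty \cos(ty)\,\mathcal{E}_\kappa\!\left(-\frac{t^2}{2}\right)dt,\quad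 y\in\mathbb{R}.$$ -/

import Mathlib

open MeasureTheory ProbabilityTheory

noncomputable section

/-- The Mittag-Leffler function `E_κ(z) = ∑_{m ≥ 0} z ^ m / Γ(κ m + 1)` of a real variable. -/
def mittagLeffler (κ z : ℝ) : ℝ :=
  ∑' m : ℕ, z ^ m / Real.Gamma (κ * m + 1)

/-- The type 2 Mittag-Leffler density
`f_κ(u) = (1 / (π κ)) ∑_{j ≥ 1} ((-1) ^ (j - 1) / j!) sin (π κ j) Γ(κ j + 1) u ^ (j - 1)`, `u > 0`.
The summation index below is `j - 1`. -/
def mittagLefflerDensity (κ u : ℝ) : ℝ :=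
  1 / (Real.pi * κ) * ∑' j : ℕ,
    (-1) ^ j / ((j + 1).factorial : ℝ) * Real.sin (Real.pi * κ * ((j : ℝ) + 1)) *
      Real.Gamma (κ * ((j : ℝ) + 1) + 1) * u ^ j

/-- The type 2 Mittag-Leffler distribution `ML(κ)`: for `κ ∈ (0, 1)` the law on `(0, ∞)` with
density `f_κ`; for `κ = 1` the degenerate law at `1`. -/
def mittagLefflerMeasure (κ : ℝ) : Measure ℝ :=
  if κ = 1 then Measure.dirac 1
  else (volume.restrict (Set.Ioi 0)).withDensity
    (fun u => ENNReal.ofReal (mittagLefflerDensity κ u))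

/-- `Y ~ NML(κ)`: `Y` has the same distribution as `√U * Z` for some independent `U ~ ML(κ)` and
`Z ~ N(0, 1)`. -/
def IsNML {Ω : Type*} [MeasurableSpace Ω] (κ : ℝ) (Y : Ω → ℝ) (P : Measure Ω) : Prop :=
  ∃ (Ω' : Type) (_ : MeasurableSpace Ω') (P' : Measure Ω') (U Z : Ω' → ℝ),
    IsProbabilityMeasure P' ∧
    HasLaw U (mittagLefflerMeasure κ) P' ∧
    HasLaw Z (gaussianReal 0 1) P' ∧
    IndepFun U Z P' ∧
    IdentDistrib Y (fun ω => √(U ω) * Z ω) P P'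

/-- The function `y ↦ (1 / π) ∫₀^∞ cos (t y) E_κ(-t² / 2) dt`. -/
def nmlDensity (κ y : ℝ) : ℝ :=
  1 / Real.pi * ∫ t in Set.Ioi (0 : ℝ), Real.cos (t * y) * mittagLeffler κ (-t ^ 2 / 2)

end

/-! Everything rests on two facts about `U ∼ ML(κ)`: its Laplace transform is `s ↦ E_κ(-s)`, and
`E[U^(-1/2)]` is finite. Given `U = u`, the variable `√u Z` is `N(0, u)`, so `φ_Y(t) = E[exp(-t² U /
2)] = E_κ(-t² / 2)`, and `Y` has density `E[g_U(y)]`, with `g_u` the `N(0, u)` density. As `∫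
exp(-t² u / 2) dt = √(2π) / √u`, the second fact makes `φ_Y` integrable and allows Fubini, which
identifies the cosine integral with this mixture; nonnegativity is then visible.

For `κ = 1` the law is a point mass and both facts are immediate. For `κ < 1` the law is given only
by an alternating series, whose sign and moments are not apparent. It is obtained as a limit. The
law `κ δ₁ + (1 - κ) Beta(i + 1, 1)` has Mellin transform `(i + 1 + κ s) / (i + 1 + s)`. The product
of such independent variables over `i < n` has an atom `κ ^ n` at `1` and a polynomial density on
`(0, 1]`, whose coefficients are the residues of the product transform
(`prod_div_eq_partialFractions`) and which is nonnegative (`sum_mlResidue_nonneg`). After scaling by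
`n ^ (1 - κ)`, Euler's limit for `Γ` shows that the coefficients tend to those of `f_κ`
(`tendsto_mlApproxCoeff`) and the moments to `m! / Γ(κ m + 1)`. A bound uniform in `n` and a Markov
tail estimate pass sign and moments to the limit (`mittagLefflerDensity_nonneg`,
`integral_pow_mul_mittagLefflerDensity`); summing the exponential series gives the Laplace
transform. -/

/-! ### Partial fractions and positivity of the polynomial densities. -/

/-- Residues at `-(j + 1)` of the rational function `s ↦ ∏_{i < n} (i + 1 + κ s) / (i + 1 + s)`. -/
noncomputable def mlResidue (κ : ℝ) (n j : ℕ) : ℝ :=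
  (-1) ^ j * (j + 1) * (n.choose (j + 1) : ℝ) *
    ∏ i ∈ Finset.range n, (1 - κ * (j + 1) / (i + 1))

/-- At an old pole the residue is multiplied by the value there of the new factor, `(n + 1 + κ s) /
(n + 1 + s) = κ + (1 - κ)(n + 1) / (n + 1 + s)` at `s = -(j + 1)`. -/
theorem mlResidue_succ_of_lt (κ : ℝ) {n j : ℕ} (h : j < n) :
    mlResidue κ (n + 1) j =
      mlResidue κ n j * (κ + (1 - κ) * (n + 1) / ((n : ℝ) - j)) := by
  have hnj : (n : ℝ) - j ≠ 0 := by
    have : (j : ℝ) < n := by exact_mod_cast h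
    linarith
  have hc : (n.choose (j + 1) : ℝ) * (n + 1) = ((n + 1).choose (j + 1) : ℝ) * ((n : ℝ) - j) := by
    have h1 := Nat.choose_mul_succ_eq n (j + 1)
    have h2 : n + 1 - (j + 1) = n - j := by omega
    rw [h2] at h1
    have h3 : ((n - j : ℕ) : ℝ) = (n : ℝ) - j := by
      rw [Nat.cast_sub h.le]
    rw [← h3]
    exact_mod_cast h1
  have hc' : ((n + 1).choose (j + 1) : ℝ) = (n.choose (j + 1) : ℝ) * (n + 1) / ((n : ℝ) - j) := by
    field_simp
    linarith
  have hn1 : (n : ℝ) + 1 ≠ 0 := by positivity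
  unfold mlResidue
  rw [Finset.prod_range_succ, hc']
  field_simp
  ring

theorem prod_range_sub_succ (n : ℕ) :
    ∏ i ∈ Finset.range n, ((i : ℝ) + 1 - (n + 1)) = (-1) ^ n * n.factorial := by
  rw [← Finset.prod_range_reflect]
  have : ∀ i ∈ Finset.range n, (((n - 1 - i : ℕ) : ℝ) + 1 - (n + 1)) = (-1) * ((i : ℝ) + 1) := by
    intro i hi
    have hi := Finset.mem_range.1 hi
    have : ((n - 1 - i : ℕ) : ℝ) + 1 + i = n := by
      have : n - 1 - i + 1 + i = n := by omega
      exact_mod_cast this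
    linarith
  rw [Finset.prod_congr rfl this, Finset.prod_mul_distrib, Finset.prod_const, Finset.card_range]
  congr 1
  rw [← Finset.prod_range_add_one_eq_factorial]
  push_cast
  rfl

/-- At the new pole, `(1 - κ)(n + 1)` is the residue of the new factor, and the earlier product is
regular and gets evaluated. -/
theorem mlResidue_succ_self (κ : ℝ) (n : ℕ) :
    mlResidue κ (n + 1) n = (1 - κ) * (n + 1) *
      ∏ i ∈ Finset.range n, ((i : ℝ) + 1 + κ * (-(n + 1))) / (i + 1 + (-(n + 1))) := by
  have h1 : ∏ i ∈ Finset.range n, ((i : ℝ) + 1 + (-(n + 1))) = (-1) ^ n * n.factorial := by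
    rw [← prod_range_sub_succ]
    rfl
  have h2 : ∏ i ∈ Finset.range n, (1 - κ * ((n : ℝ) + 1) / (i + 1)) =
      (∏ i ∈ Finset.range n, ((i : ℝ) + 1 + κ * (-(n + 1)))) / n.factorial := by
    rw [← Finset.prod_range_add_one_eq_factorial]
    push_cast
    rw [← Finset.prod_div_distrib]
    refine Finset.prod_congr rfl fun i _ => ?_
    have : (i : ℝ) + 1 ≠ 0 := by positivity
    field_simp
    ring
  have hn1 : (n : ℝ) + 1 ≠ 0 := by positivity
  have hf : (n.factorial : ℝ) ≠ 0 := by positivity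
  unfold mlResidue
  rw [Finset.prod_range_succ, Finset.prod_div_distrib, h1, h2, Nat.choose_self]
  have hs : ((-1 : ℝ) ^ n) * (-1) ^ n = 1 := by rw [← mul_pow]; simp
  have hs0 : ((-1 : ℝ) ^ n) ≠ 0 := by positivity
  field_simp
  rw [pow_two, hs]
  ring

theorem prod_div_eq_partialFractions (κ : ℝ) (n : ℕ) (s : ℝ)
    (hs : ∀ i < n, (i : ℝ) + 1 + s ≠ 0) :
    ∏ i ∈ Finset.range n, ((i : ℝ) + 1 + κ * s) / (i + 1 + s) =
      κ ^ n + ∑ j ∈ Finset.range n, mlResidue κ n j / (s + (j + 1)) := by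
  induction n generalizing s with
  | zero => simp
  | succ n ih =>
    have hne : (n : ℝ) + 1 + s ≠ 0 := hs n (Nat.lt_succ_self n)
    -- The induction hypothesis is used twice: at `s`, and at the new pole `-(n + 1)` to expand the
    -- new residue.
    rw [Finset.prod_range_succ, ih s fun i hi => hs i (hi.trans (Nat.lt_succ_self n)),
      Finset.sum_range_succ, mlResidue_succ_self, ih (-(n + 1))]
    · have hterm : ∀ j ∈ Finset.range n, mlResidue κ (n + 1) j / (s + (j + 1)) =
          mlResidue κ n j / (s + (j + 1)) * (((n : ℝ) + 1 + κ * s) / (n + 1 + s)) -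
          (1 - κ) * (n + 1) / (s + (n + 1)) * (mlResidue κ n j / (-(n + 1) + ((j : ℝ) + 1))) := by
        intro j hj
        have hj := Finset.mem_range.1 hj
        rw [mlResidue_succ_of_lt κ hj]
        have h1 : s + ((j : ℝ) + 1) ≠ 0 := by
          have := hs j (hj.trans (Nat.lt_succ_self n))
          intro h; apply this; linarith
        have h2 : s + ((n : ℝ) + 1) ≠ 0 := by
          intro h; apply hne; linarith
        have h3 : (n : ℝ) - j ≠ 0 := by
          have : (j : ℝ) < n := by exact_mod_cast hj
          linarith
        have h4 : -((n : ℝ) + 1) + ((j : ℝ) + 1) = -((n : ℝ) - j) := by ring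
        rw [h4]
        field_simp
        ring
      rw [Finset.sum_congr rfl hterm, Finset.sum_sub_distrib, ← Finset.sum_mul, ← Finset.mul_sum]
      have h2 : s + ((n : ℝ) + 1) ≠ 0 := by
        intro h; apply hne; linarith
      generalize ∑ j ∈ Finset.range n, mlResidue κ n j / (s + (j + 1)) = S
      generalize ∑ j ∈ Finset.range n, mlResidue κ n j / (-(n + 1) + ((j : ℝ) + 1)) = T
      field_simp
      ring
    · intro i hi h
      have : (i : ℝ) < n := by exact_mod_cast hi
      linarith

/-- Multiplicative convolution with `κ δ₁ + (1 - κ) Beta(n + 1, 1)`: the atom keeps the old density,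
while the beta part acts on the old atom `κ ^ n` and on the old density. Unlike the alternating
coefficients, this form shows positivity. -/
theorem sum_mlResidue_succ (κ : ℝ) (n : ℕ) {x : ℝ} (hx : 0 < x) :
    ∑ j ∈ Finset.range (n + 1), mlResidue κ (n + 1) j * x ^ j =
      κ * ∑ j ∈ Finset.range n, mlResidue κ n j * x ^ j +
      (1 - κ) * (n + 1) * x ^ n * (κ ^ n +
        ∫ y in x..1, (∑ j ∈ Finset.range n, mlResidue κ n j * y ^ j) / y ^ (n + 1)) := by
  have hint : ∫ y in x..1, (∑ j ∈ Finset.range n, mlResidue κ n j * y ^ j) / y ^ (n + 1) =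
      ∑ j ∈ Finset.range n, mlResidue κ n j * ((x ^ j / x ^ n - 1) / ((n : ℝ) - j)) := by
    have hmem : (0 : ℝ) ∉ Set.uIcc x 1 := by
      rw [Set.mem_uIcc]
      rintro (h | h) <;> linarith [h.1, h.2]
    have e1 : ∀ y ∈ Set.uIcc x 1,
        (∑ j ∈ Finset.range n, mlResidue κ n j * y ^ j) / y ^ (n + 1) =
        ∑ j ∈ Finset.range n, mlResidue κ n j * y ^ ((j : ℤ) - (n + 1)) := by
      intro y hy
      have hy0 : y ≠ 0 := fun h => hmem (h ▸ hy)
      rw [Finset.sum_div]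
      refine Finset.sum_congr rfl fun j _ => ?_
      rw [zpow_sub₀ hy0]
      norm_cast
      rw [mul_div_assoc]
    rw [intervalIntegral.integral_congr e1, intervalIntegral.integral_finsetSum]
    · refine Finset.sum_congr rfl fun j hj => ?_
      have hj := Finset.mem_range.1 hj
      rw [intervalIntegral.integral_const_mul, integral_zpow (Or.inr ⟨by omega, hmem⟩)]
      have h3 : (n : ℝ) - j ≠ 0 := by
        have : (j : ℝ) < n := by exact_mod_cast hj
        linarith
      have h4 : (((j : ℤ) - (n + 1) : ℤ) : ℝ) + 1 = -((n : ℝ) - j) := by push_cast; ring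
      rw [h4, show (j : ℤ) - (n + 1) + 1 = j - n by ring, zpow_sub₀ hx.ne', one_zpow,
        zpow_natCast, zpow_natCast]
      field_simp
      ring
    · intro j _
      refine (intervalIntegral.intervalIntegrable_zpow (Or.inr hmem)).const_mul _
  -- The contributions of the endpoint `y = 1`, together with `κ ^ n`, are the partial fraction
  -- expansion at `-(n + 1)`, hence make up the new residue.
  rw [hint, Finset.sum_range_succ, mlResidue_succ_self, prod_div_eq_partialFractions]
  · have hterm : ∀ j ∈ Finset.range n, mlResidue κ (n + 1) j * x ^ j =
          κ * (mlResidue κ n j * x ^ j) + (1 - κ) * (n + 1) * x ^ n *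
            (mlResidue κ n j * ((x ^ j / x ^ n - 1) / ((n : ℝ) - j)) -
            mlResidue κ n j / (-(n + 1) + ((j : ℝ) + 1))) := by
        intro j hj
        have hj := Finset.mem_range.1 hj
        rw [mlResidue_succ_of_lt κ hj]
        have h3 : (n : ℝ) - j ≠ 0 := by
          have : (j : ℝ) < n := by exact_mod_cast hj
          linarith
        have h4 : -((n : ℝ) + 1) + ((j : ℝ) + 1) = -((n : ℝ) - j) := by ring
        rw [h4]
        field_simp
        ring
    rw [Finset.sum_congr rfl hterm, Finset.sum_add_distrib, ← Finset.mul_sum, ← Finset.mul_sum,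
      Finset.sum_sub_distrib]
    ring
  · intro i hi h
    have : (i : ℝ) < n := by exact_mod_cast hi
    linarith

theorem sum_mlResidue_nonneg {κ : ℝ} (h0 : 0 ≤ κ) (h1 : κ ≤ 1) (n : ℕ) {x : ℝ} (hx : 0 < x)
    (hx1 : x ≤ 1) : 0 ≤ ∑ j ∈ Finset.range n, mlResidue κ n j * x ^ j := by
  induction n generalizing x with
  | zero => simp
  | succ n ih =>
    rw [sum_mlResidue_succ κ n hx]
    have hI : 0 ≤ ∫ y in x..1, (∑ j ∈ Finset.range n, mlResidue κ n j * y ^ j) / y ^ (n + 1) := by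
      refine intervalIntegral.integral_nonneg hx1 fun y hy => ?_
      have hy0 : 0 < y := hx.trans_le hy.1
      exact div_nonneg (ih hy0 hy.2) (by positivity)
    have := ih hx hx1
    have h2 : 0 ≤ 1 - κ := by linarith
    positivity

/-! ### Euler's product for `1 / Γ` and a uniform bound on its partial products. -/

open Filter Topology in
theorem tendsto_rpow_neg_mul_prod_one_add_div (s : ℝ) :
    Tendsto (fun n : ℕ => (n : ℝ) ^ (-s) * ∏ i ∈ Finset.range n, (1 + s / (i + 1))) atTop
      (𝓝 (Real.Gamma (s + 1))⁻¹) := by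
  -- At a pole of `Γ` the convention `Γ = 0`, `0⁻¹ = 0` gives the right limit, since one factor of
  -- the product vanishes.
  by_cases hG : Real.Gamma (s + 1) = 0
  · rw [Real.Gamma_eq_zero_iff] at hG
    obtain ⟨m, hm⟩ := hG
    have hG' : Real.Gamma (s + 1) = 0 := (Real.Gamma_eq_zero_iff _).2 ⟨m, hm⟩
    rw [hG', inv_zero]
    refine tendsto_const_nhds.congr' ?_
    filter_upwards [eventually_gt_atTop m] with n hn
    rw [Finset.prod_eq_zero (Finset.mem_range.2 hn), mul_zero]
    have : (m : ℝ) + 1 ≠ 0 := by positivity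
    field_simp
    linarith
  · have h1 := (Real.GammaSeq_tendsto_Gamma (s + 1)).inv₀ hG
    have h2 : Tendsto (fun n : ℕ => (n : ℝ) / (n + (s + 1))) atTop (𝓝 1) :=
      tendsto_natCast_div_add_atTop (s + 1)
    have h3 := h1.mul h2
    rw [mul_one] at h3
    refine h3.congr' ?_
    filter_upwards [eventually_gt_atTop 0, eventually_gt_atTop ⌈-(s + 1)⌉₊] with n hn hn'
    have hn0 : (0 : ℝ) < n := by exact_mod_cast hn
    have hns : (n : ℝ) + (s + 1) ≠ 0 := by
      have := (Nat.le_ceil (-(s + 1))).trans_lt (Nat.cast_lt.2 hn')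
      intro h; linarith
    have hp : ∏ i ∈ Finset.range n, (1 + s / ((i : ℝ) + 1)) =
        (∏ j ∈ Finset.range n, (s + 1 + j)) / n.factorial := by
      rw [← Finset.prod_range_add_one_eq_factorial]
      push_cast
      rw [← Finset.prod_div_distrib]
      refine Finset.prod_congr rfl fun i _ => ?_
      have : (i : ℝ) + 1 ≠ 0 := by positivity
      field_simp
      ring
    rw [Real.GammaSeq, hp, Finset.prod_range_succ, Real.rpow_add hn0, Real.rpow_one,
      Real.rpow_neg hn0.le]
    have hpow : (n : ℝ) ^ s ≠ 0 := (Real.rpow_pos_of_pos hn0 s).ne'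
    have hns' : s + 1 + (n : ℝ) ≠ 0 := by rwa [add_comm]
    field_simp
    ring

/-- While `n ≤ a`, each factor is at most `a / (i + 1)` in absolute value, so the product is at most
`a ^ n / n! ≤ exp a`. Beyond `a` the left side no longer increases: `1 - x ≤ exp (-x)` offsets the
growth of the power. -/
theorem rpow_mul_abs_prod_one_sub_div_le {a : ℝ} (ha : 0 ≤ a) (n : ℕ) :
    ((n : ℝ) + 1) ^ a * |∏ i ∈ Finset.range n, (1 - a / (i + 1))| ≤
      (Real.exp 1 * (a + 1)) ^ a := by
  have small : ∀ n : ℕ, (n : ℝ) ≤ a →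
      ((n : ℝ) + 1) ^ a * |∏ i ∈ Finset.range n, (1 - a / (i + 1))| ≤
      (Real.exp 1 * (a + 1)) ^ a := by
    intro n hn
    have h1 : |∏ i ∈ Finset.range n, (1 - a / ((i : ℝ) + 1))| ≤ Real.exp a := by
      refine le_trans ?_ (Real.pow_div_factorial_le_exp a ha n)
      rw [Finset.abs_prod, ← Finset.prod_range_add_one_eq_factorial]
      push_cast
      have : a ^ n = ∏ i ∈ Finset.range n, a := by simp
      rw [this, ← Finset.prod_div_distrib]
      refine Finset.prod_le_prod (fun _ _ => abs_nonneg _) fun i hi => ?_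
      have hi' : (i : ℝ) + 1 ≤ n := by exact_mod_cast Finset.mem_range.1 hi
      have hpos : (0 : ℝ) < (i : ℝ) + 1 := by positivity
      have : 1 ≤ a / ((i : ℝ) + 1) := by rw [le_div_iff₀ hpos]; linarith
      rw [abs_le]; constructor <;> linarith
    rw [Real.mul_rpow (Real.exp_pos 1).le (by linarith), ← Real.exp_mul, one_mul, mul_comm]
    refine mul_le_mul h1 ?_ (by positivity) (Real.exp_pos a).le
    exact Real.rpow_le_rpow (by positivity) (by linarith) ha
  induction n with
  | zero => exact small 0 (by simpa using ha)
  | succ k ih =>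
    rcases le_or_gt ((k + 1 : ℕ) : ℝ) a with h | h
    · exact small _ h
    · refine le_trans ?_ ih
      push_cast at h ⊢
      have hk : (0 : ℝ) < (k : ℝ) + 1 := by positivity
      have hq : 0 ≤ 1 - a / ((k : ℝ) + 1) := by
        rw [sub_nonneg, div_le_one hk]; exact h.le
      rw [Finset.prod_range_succ, abs_mul, abs_of_nonneg hq]
      have h1 : 1 - a / ((k : ℝ) + 1) ≤ Real.exp (-(a / (k + 1))) := Real.one_sub_le_exp_neg _
      have h2 : ((k : ℝ) + 1 + 1) ^ a ≤ ((k : ℝ) + 1) ^ a * Real.exp (a / (k + 1)) := by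
        have : (k : ℝ) + 1 + 1 ≤ ((k : ℝ) + 1) * Real.exp (1 / (k + 1)) := by
          have := Real.add_one_le_exp (1 / ((k : ℝ) + 1))
          calc (k : ℝ) + 1 + 1 = ((k : ℝ) + 1) * (1 / (k + 1) + 1) := by field_simp; ring
            _ ≤ _ := by gcongr
        calc ((k : ℝ) + 1 + 1) ^ a ≤ (((k : ℝ) + 1) * Real.exp (1 / (k + 1))) ^ a :=
              Real.rpow_le_rpow (by positivity) this ha
          _ = _ := by
              rw [Real.mul_rpow hk.le (Real.exp_pos _).le, ← Real.exp_mul]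
              congr 2
              ring
      have h3 : ((k : ℝ) + 1 + 1) ^ a * (1 - a / ((k : ℝ) + 1)) ≤ ((k : ℝ) + 1) ^ a := by
        calc ((k : ℝ) + 1 + 1) ^ a * (1 - a / ((k : ℝ) + 1)) ≤
            (((k : ℝ) + 1) ^ a * Real.exp (a / (k + 1))) * Real.exp (-(a / (k + 1))) := by gcongr
          _ = _ := by rw [mul_assoc, ← Real.exp_add]; simp
      calc _ = ((k : ℝ) + 1 + 1) ^ a * (1 - a / ((k : ℝ) + 1)) *
            |∏ i ∈ Finset.range k, (1 - a / ((i : ℝ) + 1))| := by ring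
        _ ≤ _ := by gcongr

/-! ### Rescaled coefficients: domination and limit. -/

/-- Coefficients of the density at scale `n ^ (1 - κ)` of a product of `n` independent variables
with Mellin transforms `s ↦ (i + 1 + κ s) / (i + 1 + s)`, `i < n`. -/
noncomputable def mlApproxCoeff (κ : ℝ) (n j : ℕ) : ℝ :=
  mlResidue κ n j / ((n : ℝ) ^ (1 - κ)) ^ (j + 1)

/-- The coefficients of the power series `mittagLefflerDensity κ`. -/
noncomputable def mlDensityCoeff (κ : ℝ) (j : ℕ) : ℝ :=
  1 / (Real.pi * κ) * ((-1) ^ j / ((j + 1).factorial : ℝ) *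
    Real.sin (Real.pi * κ * ((j : ℝ) + 1)) * Real.Gamma (κ * ((j : ℝ) + 1) + 1))

/-- A bound for `mlApproxCoeff κ n j`, uniform in `n`. -/
noncomputable def mlCoeffBound (κ : ℝ) (j : ℕ) : ℝ :=
  (Real.exp 1 * (κ * (j + 1) + 1)) ^ (κ * (j + 1)) / j.factorial

/-- The powers of `n` are distributed so that the binomial factor and the Euler product each stay
bounded and converge. -/
theorem mlApproxCoeff_eq {κ : ℝ} {n : ℕ} (hn : 0 < n) (j : ℕ) :
    mlApproxCoeff κ n j = (-1) ^ j * ((j + 1) * (n.choose (j + 1) : ℝ) / (n : ℝ) ^ (j + 1)) *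
      ((n : ℝ) ^ (κ * (j + 1)) * ∏ i ∈ Finset.range n, (1 - κ * (j + 1) / (i + 1))) := by
  have hn0 : (0 : ℝ) < n := by exact_mod_cast hn
  have h : ((n : ℝ) ^ (1 - κ)) ^ (j + 1) = (n : ℝ) ^ (j + 1) / (n : ℝ) ^ (κ * (j + 1)) := by
    rw [← Real.rpow_natCast, ← Real.rpow_mul hn0.le, ← Real.rpow_natCast, ← Real.rpow_sub hn0]
    congr 1
    push_cast
    ring
  have hp : (n : ℝ) ^ (κ * (j + 1)) ≠ 0 := (Real.rpow_pos_of_pos hn0 _).ne'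
  rw [mlApproxCoeff, mlResidue, h]
  field_simp

theorem abs_mlApproxCoeff_le {κ : ℝ} (h0 : 0 ≤ κ) {n : ℕ} (hn : 0 < n) (j : ℕ) :
    |mlApproxCoeff κ n j| ≤ mlCoeffBound κ j := by
  have hn0 : (0 : ℝ) < n := by exact_mod_cast hn
  have ha : 0 ≤ κ * ((j : ℝ) + 1) := by positivity
  have hb : mlCoeffBound κ j =
      (j.factorial : ℝ)⁻¹ * (Real.exp 1 * (κ * (j + 1) + 1)) ^ (κ * (j + 1)) := by
    rw [mlCoeffBound, div_eq_inv_mul]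
  rw [mlApproxCoeff_eq hn, abs_mul, abs_mul, abs_pow, abs_neg, abs_one, one_pow, one_mul, hb]
  refine mul_le_mul ?_ ?_ (abs_nonneg _) (by positivity)
  · rw [abs_of_nonneg (by positivity), div_le_iff₀ (by positivity)]
    calc ((j : ℝ) + 1) * (n.choose (j + 1) : ℝ) ≤
          ((j : ℝ) + 1) * ((n : ℝ) ^ (j + 1) / (j + 1).factorial) := by
          gcongr
          exact Nat.choose_le_pow_div (j + 1) n
      _ = _ := by
          rw [Nat.factorial_succ]
          push_cast
          field_simp
  · refine le_trans ?_ (rpow_mul_abs_prod_one_sub_div_le ha n)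
    rw [abs_mul, abs_of_nonneg (by positivity)]
    gcongr
    linarith

theorem summable_mlCoeffBound {κ : ℝ} (h0 : 0 ≤ κ) (h1 : κ < 1) (R : ℝ) (hR : 0 < R) :
    Summable fun j => mlCoeffBound κ j * R ^ j := by
  set A : ℝ := Real.exp (2 * κ) with hA
  have hApos : 0 < A := Real.exp_pos _
  -- By `k ^ k ≤ exp k * k!` with `k = j + 2`, the bound is at most of order `(k!) ^ κ / j!` up to a
  -- geometric factor. Consecutive terms of this majorant have ratio `A R (j + 3) ^ κ / (j + 1)`,
  -- which tends to `0` because `κ < 1`.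
  have hs : Summable fun j : ℕ =>
      A ^ (j + 2) * ((j + 2).factorial : ℝ) ^ κ / j.factorial * R ^ j := by
    refine summable_of_ratio_test_tendsto_lt_one (l := 0) zero_lt_one ?_ ?_
    · exact Filter.Eventually.of_forall fun j => by positivity
    · have hlim : Filter.Tendsto (fun j : ℕ => A * R * 3 * ((j : ℝ) + 1) ^ (-(1 - κ)))
          Filter.atTop (nhds 0) := by
        rw [show (0 : ℝ) = A * R * 3 * 0 by ring]
        refine Filter.Tendsto.const_mul _ ?_
        exact (tendsto_rpow_neg_atTop (by linarith : 0 < 1 - κ)).comp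
          (Filter.tendsto_atTop_add_const_right _ 1 tendsto_natCast_atTop_atTop)
      refine squeeze_zero (fun j => by positivity) (fun j => ?_) hlim
      rw [Real.norm_of_nonneg (by positivity), Real.norm_of_nonneg (by positivity)]
      have hf : ((j + 1 + 2).factorial : ℝ) ^ κ =
          ((j : ℝ) + 3) ^ κ * ((j + 2).factorial : ℝ) ^ κ := by
        rw [← Real.mul_rpow (by positivity) (by positivity), show j + 1 + 2 = (j + 2) + 1 by ring,
          Nat.factorial_succ]
        push_cast
        congr 2
        ring
      have h3 : ((j : ℝ) + 3) ^ κ ≤ 3 * ((j : ℝ) + 1) ^ κ := by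
        calc ((j : ℝ) + 3) ^ κ ≤ (3 * ((j : ℝ) + 1)) ^ κ :=
              Real.rpow_le_rpow (by positivity) (by
                have : (0 : ℝ) ≤ j := by positivity
                linarith) h0
          _ = 3 ^ κ * ((j : ℝ) + 1) ^ κ := Real.mul_rpow (by norm_num) (by positivity)
          _ ≤ 3 ^ (1 : ℝ) * ((j : ℝ) + 1) ^ κ := by
              gcongr
              norm_num
          _ = _ := by rw [Real.rpow_one]
      have h4 : ((j : ℝ) + 1) ^ (-(1 - κ)) = ((j : ℝ) + 1) ^ κ / ((j : ℝ) + 1) := by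
        rw [neg_sub, Real.rpow_sub_one (by positivity)]
      rw [hf, h4, Nat.factorial_succ j]
      push_cast
      have : ((j + 2).factorial : ℝ) ^ κ ≠ 0 := by positivity
      have e : A ^ (j + 1 + 2) * (((j : ℝ) + 3) ^ κ * ((j + 2).factorial : ℝ) ^ κ) /
          (((j : ℝ) + 1) * j.factorial) * R ^ (j + 1) /
          (A ^ (j + 2) * ((j + 2).factorial : ℝ) ^ κ / j.factorial * R ^ j) =
          A * R * ((j : ℝ) + 3) ^ κ / (j + 1) := by
        field_simp
        ring
      rw [e]
      calc A * R * ((j : ℝ) + 3) ^ κ / (j + 1) ≤ A * R * (3 * ((j : ℝ) + 1) ^ κ) / (j + 1) := by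
            gcongr
        _ = _ := by ring
  refine Summable.of_nonneg_of_le (fun j => ?_) (fun j => ?_) hs
  · unfold mlCoeffBound
    positivity
  · unfold mlCoeffBound
    gcongr
    have hj : (0 : ℝ) ≤ j := by positivity
    have hx : κ * ((j : ℝ) + 1) ≤ j + 1 := by nlinarith
    have he : 1 ≤ Real.exp 1 := Real.one_le_exp zero_le_one
    calc (Real.exp 1 * (κ * ((j : ℝ) + 1) + 1)) ^ (κ * ((j : ℝ) + 1))
        ≤ (Real.exp 1 * ((j : ℝ) + 2)) ^ (κ * ((j : ℝ) + 1)) := by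
          refine Real.rpow_le_rpow (by positivity) ?_ (by positivity)
          exact mul_le_mul_of_nonneg_left (by linarith) (Real.exp_pos 1).le
      _ ≤ (Real.exp 1 * ((j : ℝ) + 2)) ^ (((j : ℝ) + 2) * κ) := by
          refine Real.rpow_le_rpow_of_exponent_le ?_ (by nlinarith)
          nlinarith
      _ = (Real.exp ((j : ℝ) + 2) * ((j : ℝ) + 2) ^ (j + 2)) ^ κ := by
          rw [Real.rpow_mul (by positivity), Real.mul_rpow (by positivity) (by positivity),
            ← Real.exp_mul, one_mul]
          congr 2
          exact_mod_cast Real.rpow_natCast ((j : ℝ) + 2) (j + 2)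
      _ ≤ (Real.exp ((j : ℝ) + 2) * (Real.exp ((j : ℝ) + 2) * (j + 2).factorial)) ^ κ := by
          refine Real.rpow_le_rpow (by positivity) ?_ h0
          gcongr
          have := Real.pow_div_factorial_le_exp ((j : ℝ) + 2) (by positivity) (j + 2)
          rwa [div_le_iff₀ (by positivity)] at this
      _ = A ^ (j + 2) * ((j + 2).factorial : ℝ) ^ κ := by
          rw [← mul_assoc, ← Real.exp_add, Real.mul_rpow (by positivity) (by positivity),
            ← Real.exp_mul, hA, ← Real.exp_nat_mul]
          congr 2
          push_cast
          ring

open Filter Topology in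
theorem tendsto_mlApproxCoeff {κ : ℝ} (h0 : 0 < κ) (j : ℕ) :
    Tendsto (fun n => mlApproxCoeff κ n j) atTop (𝓝 (mlDensityCoeff κ j)) := by
  have hG := tendsto_rpow_neg_mul_prod_one_add_div (-(κ * ((j : ℝ) + 1)))
  have hC : Tendsto (fun n : ℕ => ((j : ℝ) + 1) * (n.choose (j + 1) : ℝ) / (n : ℝ) ^ (j + 1)) atTop
      (𝓝 (1 / (j.factorial : ℝ))) := by
    have h := (Asymptotics.isEquivalent_iff_tendsto_one ?_).1 (isEquivalent_choose (j + 1))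
    · have h2 := h.const_mul (1 / (j.factorial : ℝ))
      rw [mul_one] at h2
      refine h2.congr' ?_
      filter_upwards [eventually_gt_atTop 0] with n hn
      have hn0 : (0 : ℝ) < n := by exact_mod_cast hn
      simp only [Pi.div_apply, Nat.factorial_succ]
      push_cast
      field_simp
    · filter_upwards [eventually_gt_atTop 0] with n hn
      have hn0 : (0 : ℝ) < n := by exact_mod_cast hn
      positivity
  have h := (hC.const_mul ((-1 : ℝ) ^ j)).mul hG
  -- Reflection formula. If `κ (j + 1)` is an integer, both sides are `0`: the sine vanishes and `Γ`
  -- takes its conventional value at a pole.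
  have hval : mlDensityCoeff κ j = (-1 : ℝ) ^ j * (1 / (j.factorial : ℝ)) *
      (Real.Gamma (-(κ * ((j : ℝ) + 1)) + 1))⁻¹ := by
    have ha : 0 < κ * ((j : ℝ) + 1) := by positivity
    have hr := Real.Gamma_mul_Gamma_one_sub (κ * ((j : ℝ) + 1))
    have hg := (Real.Gamma_pos_of_pos ha).ne'
    have hval' : Real.Gamma (-(κ * ((j : ℝ) + 1)) + 1) =
        Real.pi / Real.sin (Real.pi * (κ * ((j : ℝ) + 1))) / Real.Gamma (κ * ((j : ℝ) + 1)) := by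
      rw [← hr, neg_add_eq_sub]
      field_simp
    rw [mlDensityCoeff, hval', Real.Gamma_add_one ha.ne', Nat.factorial_succ, inv_div, div_div_eq_mul_div,
      mul_assoc Real.pi κ]
    push_cast
    field_simp
  rw [hval]
  refine h.congr' ?_
  filter_upwards [eventually_gt_atTop 0] with n hn
  rw [mlApproxCoeff_eq hn, neg_neg]
  congr 2
  refine Finset.prod_congr rfl fun i _ => ?_
  ring

/-! ### Pointwise convergence of the densities. -/

open Filter Topology

/-- The absolutely continuous part of the approximating law, as a polynomial on
`(0, n ^ (1 - κ)]`. -/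
noncomputable def mlApprox (κ : ℝ) (n : ℕ) (u : ℝ) : ℝ :=
  ∑ j ∈ Finset.range n, mlApproxCoeff κ n j * u ^ j

theorem continuous_mlApprox (κ : ℝ) (n : ℕ) : Continuous (mlApprox κ n) := by
  unfold mlApprox
  fun_prop

theorem mittagLefflerDensity_eq_tsum (κ u : ℝ) :
    mittagLefflerDensity κ u = ∑' j, mlDensityCoeff κ j * u ^ j := by
  rw [mittagLefflerDensity, ← tsum_mul_left]
  congr 1
  ext j
  rw [mlDensityCoeff]
  ring

theorem mlApprox_eq_tsum (κ : ℝ) (n : ℕ) (u : ℝ) :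
    mlApprox κ n u = ∑' j, mlApproxCoeff κ n j * u ^ j := by
  rw [tsum_eq_sum (s := Finset.range n)]
  · rfl
  · intro j hj
    have : n < j + 1 := by
      rw [Finset.mem_range] at hj
      omega
    rw [mlApproxCoeff, mlResidue, Nat.choose_eq_zero_of_lt this]
    simp

theorem norm_mlApproxCoeff_mul_pow_le {κ : ℝ} (h0 : 0 ≤ κ) {n : ℕ} (hn : 0 < n) {u R : ℝ}
    (hu : |u| ≤ R) (j : ℕ) : ‖mlApproxCoeff κ n j * u ^ j‖ ≤ mlCoeffBound κ j * R ^ j := by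
  rw [norm_mul, norm_pow, Real.norm_eq_abs, Real.norm_eq_abs]
  exact mul_le_mul (abs_mlApproxCoeff_le h0 hn j) (pow_le_pow_left₀ (abs_nonneg u) hu j)
    (by positivity) ((abs_nonneg _).trans (abs_mlApproxCoeff_le h0 hn j))

theorem abs_mlApprox_le {κ : ℝ} (h0 : 0 ≤ κ) (h1 : κ < 1) {n : ℕ} (hn : 0 < n) {u R : ℝ}
    (hR : 0 < R) (hu : |u| ≤ R) : |mlApprox κ n u| ≤ ∑' j, mlCoeffBound κ j * R ^ j := by
  rw [mlApprox_eq_tsum, ← Real.norm_eq_abs]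
  exact tsum_of_norm_bounded (summable_mlCoeffBound h0 h1 R hR).hasSum
    (norm_mlApproxCoeff_mul_pow_le h0 hn hu)

theorem tendsto_mlApprox {κ : ℝ} (h0 : 0 < κ) (h1 : κ < 1) (u : ℝ) :
    Tendsto (fun n => mlApprox κ n u) atTop (𝓝 (mittagLefflerDensity κ u)) := by
  simp_rw [mlApprox_eq_tsum, mittagLefflerDensity_eq_tsum]
  -- The radius `|u| + 1` rather than `|u|` keeps it positive at `u = 0`.
  refine tendsto_tsum_of_dominated_convergence
    (summable_mlCoeffBound h0.le h1 (|u| + 1) (by positivity))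
    (fun j => (tendsto_mlApproxCoeff h0 j).mul_const _) ?_
  filter_upwards [eventually_gt_atTop 0] with n hn j
  exact norm_mlApproxCoeff_mul_pow_le h0.le hn (by linarith) j

theorem measurable_mittagLefflerDensity {κ : ℝ} (h0 : 0 < κ) (h1 : κ < 1) :
    Measurable (mittagLefflerDensity κ) :=
  measurable_of_tendsto_metrizable (fun n => (continuous_mlApprox κ n).measurable)
    (tendsto_pi_nhds.2 (tendsto_mlApprox h0 h1))

theorem abs_mittagLefflerDensity_le {κ : ℝ} (h0 : 0 < κ) (h1 : κ < 1) {u R : ℝ}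
    (hR : 0 < R) (hu : |u| ≤ R) :
    |mittagLefflerDensity κ u| ≤ ∑' j, mlCoeffBound κ j * R ^ j :=
  le_of_tendsto (tendsto_mlApprox h0 h1 u).abs <| by
    filter_upwards [eventually_gt_atTop 0] with n hn
    exact abs_mlApprox_le h0.le h1 hn hR hu

theorem mlApprox_nonneg {κ : ℝ} (h0 : 0 ≤ κ) (h1 : κ ≤ 1) (n : ℕ) {u : ℝ} (hu : 0 < u)
    (hun : u ≤ (n : ℝ) ^ (1 - κ)) : 0 ≤ mlApprox κ n u := by
  set L := (n : ℝ) ^ (1 - κ) with hL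
  have hL0 : 0 < L := hu.trans_le hun
  have h := sum_mlResidue_nonneg h0 h1 n (div_pos hu hL0) ((div_le_one hL0).2 hun)
  have : mlApprox κ n u = L⁻¹ * ∑ j ∈ Finset.range n, mlResidue κ n j * (u / L) ^ j := by
    rw [mlApprox, Finset.mul_sum]
    refine Finset.sum_congr rfl fun j _ => ?_
    rw [mlApproxCoeff, ← hL, div_pow]
    field_simp
    ring
  rw [this]
  positivity

theorem tendsto_natCast_rpow_one_sub {κ : ℝ} (h1 : κ < 1) :
    Tendsto (fun n : ℕ => (n : ℝ) ^ (1 - κ)) atTop atTop :=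
  (tendsto_rpow_atTop (by linarith)).comp tendsto_natCast_atTop_atTop

/-- The supports `(0, n ^ (1 - κ)]` exhaust the half-line, so each `u` is eventually a point where
the approximants are nonnegative. -/
theorem mittagLefflerDensity_nonneg {κ : ℝ} (h0 : 0 < κ) (h1 : κ < 1) {u : ℝ} (hu : 0 < u) :
    0 ≤ mittagLefflerDensity κ u :=
  ge_of_tendsto (tendsto_mlApprox h0 h1 u) <| by
    filter_upwards [(tendsto_natCast_rpow_one_sub h1).eventually_ge_atTop u] with n hn
    exact mlApprox_nonneg h0.le h1.le n hu hn

/-! ### Moments of the Mittag-Leffler law. -/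

/-- Integrating the monomials rebuilds the partial fractions at `s = m`; the subtracted `κ ^ n` is
the share of the atom. -/
theorem integral_pow_mul_mlApprox (κ : ℝ) {n : ℕ} (hn : 0 < n) (m : ℕ) :
    ∫ u in (0 : ℝ)..(n : ℝ) ^ (1 - κ), u ^ m * mlApprox κ n u =
      ((n : ℝ) ^ (1 - κ)) ^ m *
        (∏ i ∈ Finset.range n, ((i : ℝ) + 1 + κ * m) / (i + 1 + m) - κ ^ n) := by
  have hn0 : (0 : ℝ) < n := by exact_mod_cast hn
  have hL0 : 0 < (n : ℝ) ^ (1 - κ) := Real.rpow_pos_of_pos hn0 _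
  rw [prod_div_eq_partialFractions κ n m (fun i _ => by positivity), add_sub_cancel_left]
  simp_rw [mlApprox, Finset.mul_sum]
  rw [intervalIntegral.integral_finsetSum]
  · refine Finset.sum_congr rfl fun j _ => ?_
    have : ∀ u : ℝ, u ^ m * (mlApproxCoeff κ n j * u ^ j) = mlApproxCoeff κ n j * u ^ (m + j) :=
      fun u => by ring
    simp_rw [this]
    rw [intervalIntegral.integral_const_mul, integral_pow, mlApproxCoeff]
    have : (m : ℝ) + (j + 1) ≠ 0 := by positivity
    push_cast
    rw [zero_pow (by omega)]
    field_simp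
    ring
  · intro j _
    exact Continuous.intervalIntegrable (by fun_prop) _ _

theorem tendsto_integral_pow_mul_mlApprox {κ : ℝ} (h0 : 0 < κ) (h1 : κ < 1) (m : ℕ) :
    Tendsto (fun n : ℕ => ∫ u in (0 : ℝ)..(n : ℝ) ^ (1 - κ), u ^ m * mlApprox κ n u) atTop
      (𝓝 (m.factorial / Real.Gamma (κ * m + 1))) := by
  have hG : (Real.Gamma ((m : ℝ) + 1))⁻¹ ≠ 0 :=
    inv_ne_zero (Real.Gamma_pos_of_pos (by positivity)).ne'
  have hA := (tendsto_rpow_neg_mul_prod_one_add_div (κ * m)).div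
    (tendsto_rpow_neg_mul_prod_one_add_div (m : ℝ)) hG
  -- The atom sits at `n ^ (1 - κ)` after scaling, but its mass decays geometrically.
  have hB : Tendsto (fun n : ℕ => ((n : ℝ) ^ (1 - κ)) ^ m * κ ^ n) atTop (𝓝 0) := by
    refine squeeze_zero' (Eventually.of_forall fun n => by positivity) ?_
      (tendsto_pow_const_mul_const_pow_of_abs_lt_one m
        (show |κ| < 1 by rw [abs_of_pos h0]; exact h1))
    filter_upwards [eventually_gt_atTop 0] with n hn
    have hn1 : (1 : ℝ) ≤ n := by exact_mod_cast hn
    gcongr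
    calc (n : ℝ) ^ (1 - κ) ≤ (n : ℝ) ^ (1 : ℝ) :=
          Real.rpow_le_rpow_of_exponent_le hn1 (by linarith)
      _ = n := Real.rpow_one _
  have h := hA.sub hB
  rw [sub_zero, Real.Gamma_nat_eq_factorial, inv_div_inv] at h
  refine h.congr' ?_
  filter_upwards [eventually_gt_atTop 0] with n hn
  have hn0 : (0 : ℝ) < n := by exact_mod_cast hn
  rw [integral_pow_mul_mlApprox κ hn, mul_sub]
  congr 1
  have hp : ∏ i ∈ Finset.range n, ((i : ℝ) + 1 + κ * m) / (i + 1 + m) =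
      (∏ i ∈ Finset.range n, (1 + κ * m / ((i : ℝ) + 1))) /
        ∏ i ∈ Finset.range n, (1 + m / ((i : ℝ) + 1)) := by
    rw [← Finset.prod_div_distrib]
    refine Finset.prod_congr rfl fun i _ => ?_
    have : (i : ℝ) + 1 ≠ 0 := by positivity
    field_simp
  have hL : ((n : ℝ) ^ (1 - κ)) ^ m = (n : ℝ) ^ (-(κ * m)) / (n : ℝ) ^ (-(m : ℝ)) := by
    rw [← Real.rpow_natCast, ← Real.rpow_mul hn0.le, ← Real.rpow_sub hn0]
    congr 1
    ring
  simp only [Pi.div_apply]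
  rw [hp, hL, mul_div_mul_comm]

theorem tendsto_intervalIntegral_pow_mul_mlApprox {κ : ℝ} (h0 : 0 < κ) (h1 : κ < 1) (m : ℕ)
    {R : ℝ} (hR : 0 < R) :
    Tendsto (fun n : ℕ => ∫ u in (0 : ℝ)..R, u ^ m * mlApprox κ n u) atTop
      (𝓝 (∫ u in (0 : ℝ)..R, u ^ m * mittagLefflerDensity κ u)) := by
  refine intervalIntegral.tendsto_integral_filter_of_dominated_convergence
    (fun _ => R ^ m * ∑' j, mlCoeffBound κ j * R ^ j) ?_ ?_ ?_ ?_
  · refine Eventually.of_forall fun n => ?_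
    have := continuous_mlApprox κ n
    exact Continuous.aestronglyMeasurable (by fun_prop)
  · filter_upwards [eventually_gt_atTop 0] with n hn
    refine ae_of_all _ fun u hu => ?_
    rw [Set.uIoc_of_le hR.le] at hu
    have hu' : |u| ≤ R := by rw [abs_of_pos hu.1]; exact hu.2
    rw [norm_mul, norm_pow, Real.norm_eq_abs, Real.norm_eq_abs]
    gcongr
    exact abs_mlApprox_le h0.le h1 hn hR hu'
  · exact intervalIntegrable_const
  · exact ae_of_all _ fun u _ => (tendsto_mlApprox h0 h1 u).const_mul _

theorem intervalIntegral_pow_mul_mittagLefflerDensity_le {κ : ℝ} (h0 : 0 < κ) (h1 : κ < 1) (m : ℕ)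
    {R : ℝ} (hR : 0 < R) :
    ∫ u in (0 : ℝ)..R, u ^ m * mittagLefflerDensity κ u ≤
      m.factorial / Real.Gamma (κ * m + 1) := by
  refine le_of_tendsto_of_tendsto (tendsto_intervalIntegral_pow_mul_mlApprox h0 h1 m hR)
    (tendsto_integral_pow_mul_mlApprox h0 h1 m) ?_
  filter_upwards [(tendsto_natCast_rpow_one_sub h1).eventually_ge_atTop R] with n hn
  have := continuous_mlApprox κ n
  refine intervalIntegral.integral_mono_interval le_rfl hR.le hn ?_
    (Continuous.intervalIntegrable (by fun_prop) _ _)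
  filter_upwards [ae_restrict_mem measurableSet_Ioc] with u hu
  exact mul_nonneg (pow_nonneg hu.1.le _) (mlApprox_nonneg h0.le h1.le n hu.1 hu.2)

/-- No mass escapes to infinity: beyond `R` one has `u ^ m ≤ u ^ (m + 1) / R`, and the next moment
of the approximants converges. -/
theorem le_intervalIntegral_pow_mul_mittagLefflerDensity {κ : ℝ} (h0 : 0 < κ) (h1 : κ < 1) (m : ℕ)
    {R : ℝ} (hR : 0 < R) :
    m.factorial / Real.Gamma (κ * m + 1) -
      (m + 1).factorial / Real.Gamma (κ * (m + 1 : ℕ) + 1) / R ≤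
      ∫ u in (0 : ℝ)..R, u ^ m * mittagLefflerDensity κ u := by
  refine le_of_tendsto_of_tendsto ((tendsto_integral_pow_mul_mlApprox h0 h1 m).sub
    ((tendsto_integral_pow_mul_mlApprox h0 h1 (m + 1)).div_const R))
    (tendsto_intervalIntegral_pow_mul_mlApprox h0 h1 m hR) ?_
  filter_upwards [(tendsto_natCast_rpow_one_sub h1).eventually_ge_atTop R] with n hn
  have hc := continuous_mlApprox κ n
  have hi : ∀ (k : ℕ) (a b : ℝ), IntervalIntegrable (fun u => u ^ k * mlApprox κ n u) volume a b :=
    fun k a b => Continuous.intervalIntegrable (by fun_prop) _ _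
  rw [← intervalIntegral.integral_add_adjacent_intervals (hi m 0 R) (hi m R _), sub_le_iff_le_add]
  gcongr
  calc ∫ u in R..(n : ℝ) ^ (1 - κ), u ^ m * mlApprox κ n u ≤
        ∫ u in R..(n : ℝ) ^ (1 - κ), u ^ (m + 1) * mlApprox κ n u / R := by
        refine intervalIntegral.integral_mono_on hn (hi m _ _) ((hi (m + 1) _ _).div_const R) ?_
        intro u hu
        have hu0 : 0 < u := hR.trans_le hu.1
        rw [le_div_iff₀ hR, pow_succ]
        have := mul_nonneg (pow_nonneg hu0.le m) (mlApprox_nonneg h0.le h1.le n hu0 hu.2)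
        nlinarith [hu.1]
    _ = (∫ u in R..(n : ℝ) ^ (1 - κ), u ^ (m + 1) * mlApprox κ n u) / R :=
        intervalIntegral.integral_div _ _
    _ ≤ _ := by
        gcongr
        refine intervalIntegral.integral_mono_interval hR.le hn le_rfl ?_ (hi _ _ _)
        filter_upwards [ae_restrict_mem measurableSet_Ioc] with u hu
        exact mul_nonneg (pow_nonneg hu.1.le _) (mlApprox_nonneg h0.le h1.le n hu.1 hu.2)

theorem integrableOn_Ioc_pow_mul_mittagLefflerDensity {κ : ℝ} (h0 : 0 < κ) (h1 : κ < 1) (m : ℕ)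
    {R : ℝ} (hR : 0 < R) :
    IntegrableOn (fun u => u ^ m * mittagLefflerDensity κ u) (Set.Ioc 0 R) := by
  have hm := measurable_mittagLefflerDensity h0 h1
  refine Measure.integrableOn_of_bounded (M := R ^ m * ∑' j, mlCoeffBound κ j * R ^ j) (by simp)
    (Measurable.aestronglyMeasurable (by fun_prop)) ?_
  filter_upwards [ae_restrict_mem measurableSet_Ioc] with u hu
  have hu' : |u| ≤ R := by rw [abs_of_pos hu.1]; exact hu.2
  rw [norm_mul, norm_pow, Real.norm_eq_abs, Real.norm_eq_abs]
  gcongr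
  exact abs_mittagLefflerDensity_le h0 h1 hR hu'

theorem integrableOn_pow_mul_mittagLefflerDensity {κ : ℝ} (h0 : 0 < κ) (h1 : κ < 1) (m : ℕ) :
    IntegrableOn (fun u => u ^ m * mittagLefflerDensity κ u) (Set.Ioi 0) := by
  refine integrableOn_Ioi_of_intervalIntegral_norm_bounded (l := atTop)
    (b := fun n : ℕ => (n : ℝ) + 1)
    (m.factorial / Real.Gamma (κ * m + 1)) 0 (fun n => ?_)
    (tendsto_atTop_add_const_right _ 1 tendsto_natCast_atTop_atTop) (Eventually.of_forall fun n => ?_)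
  · exact integrableOn_Ioc_pow_mul_mittagLefflerDensity h0 h1 m (by positivity)
  · have hn : (0 : ℝ) < n + 1 := by positivity
    refine le_trans (le_of_eq ?_) (intervalIntegral_pow_mul_mittagLefflerDensity_le h0 h1 m hn)
    refine intervalIntegral.integral_congr_ae (ae_of_all _ fun u hu => ?_)
    rw [Set.uIoc_of_le hn.le] at hu
    exact Real.norm_of_nonneg
      (mul_nonneg (pow_nonneg hu.1.le _) (mittagLefflerDensity_nonneg h0 h1 hu.1))

theorem integral_pow_mul_mittagLefflerDensity {κ : ℝ} (h0 : 0 < κ) (h1 : κ < 1) (m : ℕ) :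
    ∫ u in Set.Ioi 0, u ^ m * mittagLefflerDensity κ u = m.factorial / Real.Gamma (κ * m + 1) := by
  refine tendsto_nhds_unique (intervalIntegral_tendsto_integral_Ioi 0
    (integrableOn_pow_mul_mittagLefflerDensity h0 h1 m) tendsto_id) ?_
  refine tendsto_of_tendsto_of_tendsto_of_le_of_le' (g := fun R : ℝ =>
    m.factorial / Real.Gamma (κ * m + 1) -
      (m + 1).factorial / Real.Gamma (κ * (m + 1 : ℕ) + 1) / R) ?_ tendsto_const_nhds ?_ ?_
  · have := (tendsto_const_nhds (x := (m.factorial : ℝ) / Real.Gamma (κ * m + 1))).sub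
      (tendsto_id.const_div_atTop ((m + 1).factorial / Real.Gamma (κ * (m + 1 : ℕ) + 1)))
    rwa [sub_zero] at this
  · filter_upwards [eventually_gt_atTop 0] with R hR
    exact le_intervalIntegral_pow_mul_mittagLefflerDensity h0 h1 m hR
  · filter_upwards [eventually_gt_atTop 0] with R hR
    exact intervalIntegral_pow_mul_mittagLefflerDensity_le h0 h1 m hR

/-! ### Laplace transform of the Mittag-Leffler law. -/

theorem rpow_mul_exp_neg_le_Gamma {x R : ℝ} (hx : 0 ≤ x) (hR : 0 ≤ R) :
    R ^ x * Real.exp (-R) ≤ Real.Gamma (x + 1) := by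
  have hint : IntegrableOn (fun t : ℝ => Real.exp (-t) * t ^ x) (Set.Ioi 0) := by
    simpa using Real.GammaIntegral_convergent (s := x + 1) (by linarith)
  rw [Real.Gamma_eq_integral (by linarith)]
  simp only [add_sub_cancel_right]
  have hsub : Set.Ioi R ⊆ Set.Ioi (0 : ℝ) := Set.Ioi_subset_Ioi hR
  calc R ^ x * Real.exp (-R) = ∫ t in Set.Ioi R, R ^ x * Real.exp (-t) := by
        rw [integral_const_mul, integral_exp_neg_Ioi]
    _ ≤ ∫ t in Set.Ioi R, Real.exp (-t) * t ^ x := by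
        refine setIntegral_mono_on ((integrableOn_exp_neg_Ioi R).const_mul _)
          (hint.mono_set hsub) measurableSet_Ioi fun t ht => ?_
        rw [mul_comm]
        gcongr
        exact le_of_lt ht
    _ ≤ _ := by
        refine setIntegral_mono_set hint ?_ hsub.eventuallyLE
        filter_upwards [ae_restrict_mem measurableSet_Ioi] with t ht
        have : (0 : ℝ) < t := ht
        positivity

theorem summable_pow_div_Gamma {κ : ℝ} (h0 : 0 < κ) {s : ℝ} (hs : 0 ≤ s) :
    Summable fun m : ℕ => s ^ m / Real.Gamma (κ * m + 1) := by
  -- Chosen so that `R ^ (κ m) = (2 (s + 1)) ^ m`, which leaves a geometric series of ratio `1 / 2`.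
  set R : ℝ := (2 * (s + 1)) ^ κ⁻¹ with hR
  have hRpos : 0 < R := by positivity
  have hRκ : R ^ κ = 2 * (s + 1) := by
    rw [hR, ← Real.rpow_mul (by positivity), inv_mul_cancel₀ h0.ne', Real.rpow_one]
  refine Summable.of_nonneg_of_le (fun m => ?_) (fun m => ?_)
    (summable_geometric_two.mul_left (Real.exp R))
  · have := Real.Gamma_pos_of_pos (show 0 < κ * m + 1 by positivity)
    positivity
  · have hG := rpow_mul_exp_neg_le_Gamma (show 0 ≤ κ * m by positivity) hRpos.le
    rw [Real.rpow_mul hRpos.le, hRκ, Real.rpow_natCast] at hG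
    calc s ^ m / Real.Gamma (κ * m + 1) ≤ (s + 1) ^ m / ((2 * (s + 1)) ^ m * Real.exp (-R)) := by
          gcongr
          linarith
      _ = _ := by
          rw [mul_pow, Real.exp_neg, one_div, inv_pow]
          field_simp

/-- Termwise integration of the exponential series: the `m!` of the moments cancels, and the
absolute values sum to `E_κ(s)`, which is finite. -/
theorem integral_exp_neg_mul_mittagLefflerDensity {κ : ℝ} (h0 : 0 < κ) (h1 : κ < 1) {s : ℝ}
    (hs : 0 ≤ s) :
    ∫ u in Set.Ioi 0, Real.exp (-(s * u)) * mittagLefflerDensity κ u = mittagLeffler κ (-s) := by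
  have hI : ∀ m : ℕ, Integrable (fun u => (-s) ^ m / m.factorial *
      (u ^ m * mittagLefflerDensity κ u)) (volume.restrict (Set.Ioi 0)) := fun m =>
    (integrableOn_pow_mul_mittagLefflerDensity h0 h1 m).const_mul _
  have h := hasSum_integral_of_summable_integral_norm hI ?_
  · rw [mittagLeffler]
    have hterm : ∀ m : ℕ, (-s) ^ m / Real.Gamma (κ * m + 1) = ∫ u in Set.Ioi 0,
        (-s) ^ m / m.factorial * (u ^ m * mittagLefflerDensity κ u) := by
      intro m
      rw [integral_const_mul, integral_pow_mul_mittagLefflerDensity h0 h1]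
      have : (m.factorial : ℝ) ≠ 0 := by positivity
      field_simp
    simp_rw [hterm]
    rw [h.tsum_eq]
    refine integral_congr_ae (ae_of_all _ fun u => ?_)
    simp only
    have : ∀ m : ℕ, (-s) ^ m / m.factorial * (u ^ m * mittagLefflerDensity κ u) =
        (-(s * u)) ^ m / m.factorial * mittagLefflerDensity κ u := by
      intro m
      rw [← neg_mul, mul_pow]
      ring
    simp_rw [this]
    rw [tsum_mul_right, Real.exp_eq_exp_ℝ, NormedSpace.exp_eq_tsum_div]
  · refine (summable_pow_div_Gamma h0 hs).congr fun m => ?_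
    have : ∫ u in Set.Ioi 0, ‖(-s) ^ m / m.factorial * (u ^ m * mittagLefflerDensity κ u)‖ =
        ∫ u in Set.Ioi 0, s ^ m / m.factorial * (u ^ m * mittagLefflerDensity κ u) := by
      refine setIntegral_congr_fun measurableSet_Ioi fun u hu => ?_
      have hu : (0 : ℝ) < u := hu
      have hf := mittagLefflerDensity_nonneg h0 h1 hu
      simp only [norm_mul, norm_div, norm_pow, norm_neg, Real.norm_eq_abs, abs_of_nonneg hs,
        abs_of_nonneg hf, abs_of_pos hu, Nat.abs_cast]
    rw [this, integral_const_mul, integral_pow_mul_mittagLefflerDensity h0 h1]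
    have : (m.factorial : ℝ) ≠ 0 := by positivity
    field_simp

theorem mittagLeffler_one (z : ℝ) : mittagLeffler 1 z = Real.exp z := by
  rw [mittagLeffler, Real.exp_eq_exp_ℝ, NormedSpace.exp_eq_tsum_div]
  simp [Real.Gamma_nat_eq_factorial]

/-! ### Gaussian variance mixtures and Fourier inversion. -/

/-- Up to normalisation, `t ↦ exp (-t² u / 2)` is the `N(0, 1 / u)` density, so this is the real
part of a known characteristic function. -/
theorem integral_cos_mul_exp_neg_sq {u : ℝ} (hu : 0 < u) (y : ℝ) :
    ∫ t : ℝ, Real.cos (t * y) * Real.exp (-(t ^ 2 / 2 * u)) =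
      2 * Real.pi * gaussianPDFReal 0 u.toNNReal y := by
  have hv : (u⁻¹).toNNReal ≠ 0 := by simpa using hu
  have h := charFun_gaussianReal (μ := 0) (v := (u⁻¹).toNNReal) y
  rw [charFun_apply_real, integral_gaussianReal_eq_integral_smul hv] at h
  have hint : Integrable (fun t : ℝ => gaussianPDFReal 0 (u⁻¹).toNNReal t •
      Complex.exp (y * t * Complex.I)) := by
    have := (integrable_gaussianPDFReal 0 (u⁻¹).toNNReal)
    refine (this.ofReal (𝕜 := ℂ)).mono (by fun_prop) (ae_of_all _ fun t => ?_)
    have e : ‖Complex.exp (y * t * Complex.I)‖ = 1 := by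
      exact_mod_cast Complex.norm_exp_ofReal_mul_I (y * t)
    rw [norm_smul, e]
    simp
  have h2 := congrArg Complex.re h
  rw [← RCLike.re_eq_complex_re, ← integral_re hint] at h2
  have e1 : ∀ t : ℝ, RCLike.re (gaussianPDFReal 0 (u⁻¹).toNNReal t •
      Complex.exp (y * t * Complex.I)) = (√(2 * Real.pi * u⁻¹))⁻¹ *
        (Real.cos (t * y) * Real.exp (-(t ^ 2 / 2 * u))) := by
    intro t
    have e : Complex.exp (y * t * Complex.I) = Complex.exp (((t * y : ℝ) : ℂ) * Complex.I) := by
      push_cast; ring_nf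
    rw [e, RCLike.re_eq_complex_re, Complex.real_smul, Complex.re_ofReal_mul,
      Complex.exp_ofReal_mul_I_re, gaussianPDFReal, Real.coe_toNNReal _ (by positivity)]
    have : -(t - 0) ^ 2 / (2 * u⁻¹) = -(t ^ 2 / 2 * u) := by field_simp; ring
    rw [this]
    ring
  have e2 : RCLike.re (Complex.exp (y * (0 : ℝ) * Complex.I -
      ((u⁻¹).toNNReal : ℝ) * (y : ℂ) ^ 2 / 2)) = Real.exp (-(y ^ 2 / (2 * u))) := by
    have : ((y : ℂ) * (0 : ℝ) * Complex.I - ((u⁻¹).toNNReal : ℝ) * (y : ℂ) ^ 2 / 2) =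
        ((-(y ^ 2 / (2 * u)) : ℝ) : ℂ) := by
      rw [Real.coe_toNNReal _ (by positivity)]
      push_cast
      field_simp
      ring
    rw [this, ← Complex.ofReal_exp, RCLike.re_eq_complex_re, Complex.ofReal_re]
  simp_rw [e1] at h2
  rw [e2, integral_const_mul] at h2
  have hs : (√(2 * Real.pi * u⁻¹)) ≠ 0 := by positivity
  have h3 : ∫ t : ℝ, Real.cos (t * y) * Real.exp (-(t ^ 2 / 2 * u)) =
      √(2 * Real.pi * u⁻¹) * Real.exp (-(y ^ 2 / (2 * u))) := by
    rw [← h2, mul_inv_cancel_left₀ hs]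
  rw [h3, gaussianPDFReal, Real.coe_toNNReal _ hu.le, sub_zero]
  have e3 : √(2 * Real.pi * u⁻¹) = 2 * Real.pi * (√(2 * Real.pi * u))⁻¹ := by
    have hs' : √(2 * Real.pi * u) ≠ 0 := by positivity
    rw [eq_mul_inv_iff_mul_eq₀ hs', ← Real.sqrt_mul (by positivity),
      show 2 * Real.pi * u⁻¹ * (2 * Real.pi * u) = (2 * Real.pi) * (2 * Real.pi) by field_simp,
      Real.sqrt_mul_self (by positivity)]
  rw [e3]
  ring_nf

theorem integral_exp_neg_sq_mul {u : ℝ} (hu : 0 < u) :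
    ∫ t : ℝ, Real.exp (-(t ^ 2 / 2 * u)) = √(2 * Real.pi) * (√u)⁻¹ := by
  have h := integral_gaussian (u / 2)
  rw [← Real.sqrt_inv, ← Real.sqrt_mul (by positivity), ← div_eq_mul_inv]
  rw [show 2 * Real.pi / u = Real.pi / (u / 2) by field_simp, ← h]
  congr 1
  ext t
  ring_nf

theorem integrable_exp_neg_sq_mul {u : ℝ} (hu : 0 < u) :
    Integrable fun t : ℝ => Real.exp (-(t ^ 2 / 2 * u)) := by
  refine (integrable_exp_neg_mul_sq (show 0 < u / 2 by positivity)).congr (ae_of_all _ fun t => ?_)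
  ring_nf

theorem integrable_prod_exp_neg_sq_mul {μ : Measure ℝ} [SFinite μ]
    (hpos : ∀ᵐ u ∂μ, 0 < u)
    (hint : Integrable (fun u => (√u)⁻¹) μ) :
    Integrable (fun p : ℝ × ℝ => Real.exp (-(p.1 ^ 2 / 2 * p.2))) (volume.prod μ) := by
  rw [integrable_prod_iff' (Measurable.aestronglyMeasurable (by fun_prop))]
  refine ⟨?_, ?_⟩
  · filter_upwards [hpos] with u hu using integrable_exp_neg_sq_mul hu
  · refine (hint.const_mul √(2 * Real.pi)).congr ?_
    filter_upwards [hpos] with u hu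
    simp_rw [Real.norm_of_nonneg (Real.exp_pos _).le]
    exact (integral_exp_neg_sq_mul hu).symm

theorem integrable_integral_exp_neg_sq_mul {μ : Measure ℝ} [SFinite μ]
    (hpos : ∀ᵐ u ∂μ, 0 < u)
    (hint : Integrable (fun u => (√u)⁻¹) μ) :
    Integrable (fun t : ℝ => ∫ u, Real.exp (-(t ^ 2 / 2 * u)) ∂μ) :=
  (integrable_prod_exp_neg_sq_mul hpos hint).integral_prod_left

theorem integral_cos_mul_integral_exp_neg_sq_mul {μ : Measure ℝ} [SFinite μ]
    (hpos : ∀ᵐ u ∂μ, 0 < u)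
    (hint : Integrable (fun u => (√u)⁻¹) μ) (y : ℝ) :
    1 / Real.pi * ∫ t in Set.Ioi (0 : ℝ),
      Real.cos (t * y) * ∫ u, Real.exp (-(t ^ 2 / 2 * u)) ∂μ =
      ∫ u, gaussianPDFReal 0 u.toNNReal y ∂μ := by
  -- The integrand is even in `t`, so the half-line integral is half of the integral over the whole
  -- line, where Fubini is applied.
  have habs := integral_comp_abs
    (f := fun t : ℝ => Real.cos (t * y) * ∫ u, Real.exp (-(t ^ 2 / 2 * u)) ∂μ)
  have hcos : ∀ t : ℝ, Real.cos (|t| * y) = Real.cos (t * y) := by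
    intro t
    rcases abs_choice t with h | h <;> rw [h]
    rw [neg_mul, Real.cos_neg]
  simp_rw [sq_abs, hcos] at habs
  have hI : Integrable (fun p : ℝ × ℝ => Real.cos (p.1 * y) * Real.exp (-(p.1 ^ 2 / 2 * p.2)))
      (volume.prod μ) := by
    refine (integrable_prod_exp_neg_sq_mul hpos hint).bdd_mul (c := 1)
      (Measurable.aestronglyMeasurable (by fun_prop)) (ae_of_all _ fun p => ?_)
    exact Real.abs_cos_le_one _
  have hswap : ∫ t : ℝ, Real.cos (t * y) * ∫ u, Real.exp (-(t ^ 2 / 2 * u)) ∂μ =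
      ∫ u, (∫ t : ℝ, Real.cos (t * y) * Real.exp (-(t ^ 2 / 2 * u))) ∂μ := by
    simp_rw [← integral_const_mul]
    exact integral_integral_swap hI
  have hin : ∫ u, (∫ t : ℝ, Real.cos (t * y) * Real.exp (-(t ^ 2 / 2 * u))) ∂μ =
      2 * Real.pi * ∫ u, gaussianPDFReal 0 u.toNNReal y ∂μ := by
    rw [← integral_const_mul]
    refine integral_congr_ae ?_
    filter_upwards [hpos] with u hu using integral_cos_mul_exp_neg_sq hu y
  rw [hswap, hin] at habs
  rw [one_div, inv_mul_eq_iff_eq_mul₀ Real.pi_pos.ne']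
  linarith

theorem integrable_gaussianPDFReal_toNNReal {μ : Measure ℝ}
    (hpos : ∀ᵐ u ∂μ, 0 < u)
    (hint : Integrable (fun u => (√u)⁻¹) μ) (y : ℝ) :
    Integrable (fun u => gaussianPDFReal 0 u.toNNReal y) μ := by
  refine hint.mono (Measurable.aestronglyMeasurable ?_) ?_
  · unfold gaussianPDFReal
    fun_prop
  · filter_upwards [hpos] with u hu
    rw [Real.norm_of_nonneg (gaussianPDFReal_nonneg _ _ _), Real.norm_of_nonneg (by positivity),
      gaussianPDFReal, Real.coe_toNNReal _ hu.le]
    calc (√(2 * Real.pi * u))⁻¹ * Real.exp (-(y - 0) ^ 2 / (2 * u)) ≤ (√u)⁻¹ * 1 := by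
          gcongr
          · have := Real.pi_gt_three
            nlinarith
          · rw [Real.exp_le_one_iff]
            exact div_nonpos_of_nonpos_of_nonneg (by nlinarith [sq_nonneg (y - 0)]) (by positivity)
      _ = _ := mul_one _

theorem charFun_map_sqrt_mul_gaussian {μ : Measure ℝ} [IsFiniteMeasure μ]
    (hpos : ∀ᵐ u ∂μ, 0 < u) (t : ℝ) :
    charFun ((μ.prod (gaussianReal 0 1)).map fun p => √p.1 * p.2) t =
      ((∫ u, Real.exp (-(t ^ 2 / 2 * u)) ∂μ : ℝ) : ℂ) := by
  have hm : Measurable fun p : ℝ × ℝ => √p.1 * p.2 := by fun_prop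
  rw [charFun_apply_real, integral_map hm.aemeasurable (by fun_prop), integral_prod,
    ← integral_complex_ofReal]
  · refine integral_congr_ae ?_
    filter_upwards [hpos] with u hu
    have h := charFun_gaussianReal (μ := 0) (v := 1) (t * √u)
    rw [charFun_apply_real] at h
    have e : ∀ z : ℝ, Complex.exp (t * ((√u * z : ℝ) : ℂ) * Complex.I) =
        Complex.exp (((t * √u : ℝ) : ℂ) * z * Complex.I) := by
      intro z
      push_cast
      ring_nf
    simp_rw [e]
    rw [h, Complex.ofReal_exp]
    congr 1
    have : ((√u : ℝ) : ℂ) ^ 2 = u := by exact_mod_cast Real.sq_sqrt hu.le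
    push_cast
    rw [mul_pow, this]
    ring
  · refine (integrable_const (1 : ℝ)).mono (by fun_prop) (ae_of_all _ fun p => ?_)
    have : ‖Complex.exp (t * ((√p.1 * p.2 : ℝ) : ℂ) * Complex.I)‖ = 1 := by
      exact_mod_cast Complex.norm_exp_ofReal_mul_I (t * (√p.1 * p.2))
    rw [this]
    simp

theorem map_sqrt_mul_gaussian_eq_withDensity {μ : Measure ℝ} [SFinite μ]
    (hpos : ∀ᵐ u ∂μ, 0 < u)
    (hint : Integrable (fun u => (√u)⁻¹) μ) :
    (μ.prod (gaussianReal 0 1)).map (fun p => √p.1 * p.2) =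
      volume.withDensity fun y => ENNReal.ofReal (∫ u, gaussianPDFReal 0 u.toNNReal y ∂μ) := by
  have hm : Measurable fun p : ℝ × ℝ => √p.1 * p.2 := by fun_prop
  ext B hB
  rw [Measure.map_apply hm hB, Measure.prod_apply (hm hB), withDensity_apply _ hB]
  have h1 : ∫⁻ u, gaussianReal 0 1 (Prod.mk u ⁻¹' ((fun p : ℝ × ℝ => √p.1 * p.2) ⁻¹' B)) ∂μ =
      ∫⁻ u, (∫⁻ y in B, gaussianPDF 0 u.toNNReal y) ∂μ := by
    refine lintegral_congr_ae ?_
    filter_upwards [hpos] with u hu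
    have hu' : u.toNNReal ≠ 0 := by simpa using hu
    rw [← gaussianReal_apply 0 hu']
    have h2 := gaussianReal_map_const_mul (μ := 0) (v := 1) (√u)
    have h3 : (NNReal.mk (√u ^ 2) (sq_nonneg _)) * 1 = u.toNNReal := by
      ext
      simp [Real.sq_sqrt hu.le, hu.le]
    rw [h3, mul_zero] at h2
    rw [← h2, Measure.map_apply (by fun_prop) hB]
    rfl
  rw [h1, lintegral_lintegral_swap]
  · refine lintegral_congr fun y => ?_
    rw [ofReal_integral_eq_lintegral_ofReal (integrable_gaussianPDFReal_toNNReal hpos hint y)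
      (ae_of_all _ fun u => gaussianPDFReal_nonneg _ _ _)]
    rfl
  · unfold gaussianPDF gaussianPDFReal
    exact Measurable.aemeasurable (by fun_prop)

/-! ### The mixing law `ML(κ)`, including the degenerate case. -/

theorem ae_pos_mittagLefflerMeasure (κ : ℝ) : ∀ᵐ u ∂mittagLefflerMeasure κ, 0 < u := by
  unfold mittagLefflerMeasure
  split_ifs
  · rw [ae_dirac_iff measurableSet_Ioi]
    exact one_pos
  · exact (withDensity_absolutelyContinuous _ _).ae_le (ae_restrict_mem measurableSet_Ioi)

theorem integral_exp_neg_mittagLefflerMeasure {κ : ℝ} (h0 : 0 < κ) (h1 : κ ≤ 1) {s : ℝ}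
    (hs : 0 ≤ s) :
    ∫ u, Real.exp (-(s * u)) ∂mittagLefflerMeasure κ = mittagLeffler κ (-s) := by
  unfold mittagLefflerMeasure
  split_ifs with h
  · rw [integral_dirac, h, mittagLeffler_one, mul_one]
  · have h1 := lt_of_le_of_ne h1 h
    have hm := measurable_mittagLefflerDensity h0 h1
    rw [integral_withDensity_eq_integral_toReal_smul (by fun_prop) (by simp),
      ← integral_exp_neg_mul_mittagLefflerDensity h0 h1 hs]
    refine setIntegral_congr_fun measurableSet_Ioi fun u hu => ?_
    rw [ENNReal.toReal_ofReal (mittagLefflerDensity_nonneg h0 h1 hu), smul_eq_mul, mul_comm]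

/-- For `κ < 1`, the density is bounded on `(0, 1]`, where `u ^ (-1/2)` is integrable, and beyond
`1` the weight is at most `1`. -/
theorem integrable_inv_sqrt_mittagLefflerMeasure {κ : ℝ} (h0 : 0 < κ) (h1 : κ ≤ 1) :
    Integrable (fun u => (√u)⁻¹) (mittagLefflerMeasure κ) := by
  unfold mittagLefflerMeasure
  split_ifs with h
  · exact integrable_dirac (by simp)
  · have h1 := lt_of_le_of_ne h1 h
    have hm := measurable_mittagLefflerDensity h0 h1
    rw [integrable_withDensity_iff_integrable_smul' (by fun_prop) (by simp)]
    set S : ℝ := ∑' j, mlCoeffBound κ j * 1 ^ j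
    have hf := integrableOn_pow_mul_mittagLefflerDensity h0 h1 0
    simp only [pow_zero, one_mul] at hf
    have hu : IntegrableOn (fun u : ℝ => (√u)⁻¹) (Set.Ioc 0 1) := by
      have := (intervalIntegral.intervalIntegrable_rpow' (a := 0) (b := 1)
        (show (-1 : ℝ) < -(1 / 2) by norm_num)).1
      refine this.congr_fun (fun u hu => ?_) measurableSet_Ioc
      simp only
      rw [Real.rpow_neg hu.1.le, Real.sqrt_eq_rpow]
    have hu' : Integrable ((Set.Ioc (0 : ℝ) 1).indicator fun u => S * (√u)⁻¹)
        (volume.restrict (Set.Ioi 0)) :=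
      ((integrable_indicator_iff measurableSet_Ioc).2 (hu.const_mul S)).restrict
    refine (hu'.add hf).mono (Measurable.aestronglyMeasurable (by fun_prop)) ?_
    filter_upwards [ae_restrict_mem measurableSet_Ioi] with u hu
    have hu : 0 < u := hu
    have hfu := mittagLefflerDensity_nonneg h0 h1 hu
    rw [ENNReal.toReal_ofReal hfu, smul_eq_mul, Real.norm_of_nonneg (by positivity)]
    refine le_trans ?_ (Real.le_norm_self _)
    rw [Pi.add_apply]
    by_cases hu1 : u ≤ 1
    · rw [Set.indicator_of_mem (Set.mem_Ioc.2 ⟨hu, hu1⟩)]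
      have hb := abs_mittagLefflerDensity_le h0 h1 one_pos
        (show |u| ≤ 1 by rwa [abs_of_pos hu])
      have hb' : mittagLefflerDensity κ u ≤ S := (le_abs_self _).trans hb
      have : mittagLefflerDensity κ u * (√u)⁻¹ ≤ S * (√u)⁻¹ := by gcongr
      linarith
    · rw [Set.indicator_of_notMem (fun hmem => hu1 hmem.2), zero_add]
      refine mul_le_of_le_one_right hfu (inv_le_one_of_one_le₀ ?_)
      rw [Real.one_le_sqrt]
      linarith

theorem proposition2 {Ω : Type*} [MeasurableSpace Ω] (P : Measure Ω) [IsProbabilityMeasure P]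
    (κ : ℝ) (hκ0 : 0 < κ) (hκ1 : κ ≤ 1) (Y : Ω → ℝ) (hY : IsNML κ Y P) :
    (∀ t : ℝ, charFun (P.map Y) t = ((mittagLeffler κ (-t ^ 2 / 2) : ℝ) : ℂ)) ∧
    Integrable (fun t : ℝ => mittagLeffler κ (-t ^ 2 / 2)) volume ∧
    (∀ y : ℝ, 0 ≤ nmlDensity κ y) ∧
    HasLaw Y (volume.withDensity (fun y => ENNReal.ofReal (nmlDensity κ y))) P := by
  obtain ⟨Ω', _, P', U, Z, _, hU, hZ, hind, hid⟩ := hY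
  -- Total mass one is inherited from `P'`, as `mittagLefflerMeasure κ` is the law of `U`.
  have : IsProbabilityMeasure (mittagLefflerMeasure κ) := by
    rw [← hU.map_eq]
    exact Measure.isProbabilityMeasure_map hU.aemeasurable
  have hpos := ae_pos_mittagLefflerMeasure κ
  have hint := integrable_inv_sqrt_mittagLefflerMeasure hκ0 hκ1
  have hE : ∀ t : ℝ, mittagLeffler κ (-t ^ 2 / 2) =
      ∫ u, Real.exp (-(t ^ 2 / 2 * u)) ∂mittagLefflerMeasure κ := by
    intro t
    rw [integral_exp_neg_mittagLefflerMeasure hκ0 hκ1 (by positivity), neg_div]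
  have hdens : ∀ y, nmlDensity κ y =
      ∫ u, gaussianPDFReal 0 u.toNNReal y ∂mittagLefflerMeasure κ := by
    intro y
    rw [nmlDensity, ← integral_cos_mul_integral_exp_neg_sq_mul hpos hint]
    simp_rw [hE]
  have hmap : P.map Y = ((mittagLefflerMeasure κ).prod (gaussianReal 0 1)).map
      (fun p => √p.1 * p.2) := by
    rw [hid.map_eq, ← hU.map_eq, ← hZ.map_eq,
      ← (indepFun_iff_map_prod_eq_prod_map_map hU.aemeasurable hZ.aemeasurable).1 hind,
      AEMeasurable.map_map_of_aemeasurable (by fun_prop) (hU.aemeasurable.prodMk hZ.aemeasurable)]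
    rfl
  refine ⟨fun t => ?_, ?_, fun y => ?_, hid.aemeasurable_fst, ?_⟩
  · rw [hmap, charFun_map_sqrt_mul_gaussian hpos, hE]
  · simp_rw [hE]
    exact integrable_integral_exp_neg_sq_mul hpos hint
  · rw [hdens]
    exact integral_nonneg fun u => gaussianPDFReal_nonneg _ _ _
  · rw [hmap, map_sqrt_mul_gaussian_eq_withDensity hpos hint]
    simp_rw [hdens]
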